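/- Let $R$ be a (unital, associative, not necessarily commutative) ring, write $\mathrm{GL}(1,R)$ for the set of its two-sided invertible elements, and for $a\in R$ put $\mathrm{GL}(1,R)-a=\{u-a : u\in \mathrm{GL}(1,R)\}$. Say that $R$ satisfies condition $((3))$ if for all $a_1,a_2,a_3\in R$, not necessarily distinct, $$\bigcap_{j=1}^{3}\bigl(\mathrm{GL}(1,R)-a_j\bigr)\neq\emptyset .$$ Suppose that $R$ is right artinian or left artinian. Then $R$ satisfies condition $((3))$ if and only if $R$ has no homomorphic image isomorphic to any one of the rings $F_2$, $M_2(F_2)$, $F_3$, where $F_q$ denotes the field with $q$ elements and $M_2(F_2)$ the ring of $2\times 2$ matrices over $F_2$. -/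

import Mathlib

/-- The translate `GL(1,R) - a = {u - a | u a two-sided invertible element of R}`. -/
def unitTranslate (R : Type*) [Ring R] (a : R) : Set R :=
  {x | ∃ u : Rˣ, x = (u : R) - a}

/-- The intersection-of-translates condition `((n))`: any `n` translates
`GL(1,R) - a 1, …, GL(1,R) - a n` of the group of invertibles have a common element.
The elements `a i` are an arbitrary family, so repetitions are allowed. -/
def SatisfiesTranslateCondition (R : Type*) [Ring R] (n : ℕ) : Prop :=
  ∀ a : Fin n → R, (⋂ i, unitTranslate R (a i)).Nonempty

/-- `R` has a homomorphic image (as a unital ring) isomorphic to `S`. -/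
def HasHomomorphicImage (R S : Type*) [Ring R] [Ring S] : Prop :=
  ∃ f : R →+* S, Function.Surjective f

/-!
Invertibility can be tested modulo the Jacobson radical, so when `R ⧸ J` is semisimple,
Artin–Wedderburn reduces the condition to matrix rings over division rings. A division ring
satisfies it exactly when it has more than three elements.

To enlarge matrices, shift by a block diagonal matrix: once every top left block has become
invertible, only the Schur complements remain, and they are matrices of the smaller size. Over a
small division ring the top left entries are handled by first multiplying on the left by an
invertible matrix that makes them all equal to some `t`; shifting them by `1 - t` turns every pivot
into `1`. This lifts the condition from `k × k` to larger matrices as soon as `2 ≤ k`. The base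
cases are the `3 × 3` matrices over `F₂` and the `2 × 2` matrices over `F₃`; there one matrix of the
triple may be assumed to be `0` and another one to be in rank normal form, and what is left is a
finite check.
-/

open Matrix

namespace HasHomomorphicImage

variable {R S T : Type*} [Ring R] [Ring S] [Ring T]

theorem of_ringEquiv (e : R ≃+* S) : HasHomomorphicImage R S :=
  ⟨e.toRingHom, e.surjective⟩

theorem trans (hRS : HasHomomorphicImage R S) (hST : HasHomomorphicImage S T) :
    HasHomomorphicImage R T := by
  obtain ⟨f, hf⟩ := hRS
  obtain ⟨g, hg⟩ := hST
  exact ⟨g.comp f, hg.comp hf⟩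

end HasHomomorphicImage

/-- The family `a` has a *unit shift*: some `x` makes every `x + a i` invertible. Equivalently, the
translates `GL(1,R) - a i` have a common element. -/
def HasUnitShift {ι R : Type*} [Ring R] (a : ι → R) : Prop :=
  ∃ x, ∀ i, IsUnit (x + a i)

namespace HasUnitShift

variable {ι R S : Type*} [Ring R] [Ring S] {a : ι → R}

theorem map (h : HasUnitShift a) (f : R →+* S) : HasUnitShift (f ∘ a) := by
  obtain ⟨x, hx⟩ := h
  exact ⟨f x, fun i => by simpa using (hx i).map f⟩

theorem of_map (f : R →+* S) [IsLocalHom f] (hf : Function.Surjective f)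
    (h : HasUnitShift (f ∘ a)) : HasUnitShift a := by
  obtain ⟨y, hy⟩ := h
  obtain ⟨x, rfl⟩ := hf y
  exact ⟨x, fun i => isUnit_of_map_unit f _ (by simpa using hy i)⟩

theorem of_add_const (c : R) (h : HasUnitShift fun i => a i + c) : HasUnitShift a := by
  obtain ⟨x, hx⟩ := h
  exact ⟨x + c, fun i => by simpa only [add_assoc, add_comm c] using hx i⟩

theorem of_mul_mul {p q : R} (hp : IsUnit p) (hq : IsUnit q)
    (h : HasUnitShift fun i => p * a i * q) : HasUnitShift a := by
  obtain ⟨p, rfl⟩ := hp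
  obtain ⟨q, rfl⟩ := hq
  obtain ⟨x, hx⟩ := h
  refine ⟨↑p⁻¹ * x * ↑q⁻¹, fun i => ?_⟩
  rw [← Units.isUnit_units_mul p, ← Units.isUnit_mul_units _ q]
  simpa [mul_add, add_mul, mul_assoc] using hx i

end HasUnitShift

theorem satisfiesTranslateCondition_iff_forall_hasUnitShift {R : Type*} [Ring R] {n : ℕ} :
    SatisfiesTranslateCondition R n ↔ ∀ a : Fin n → R, HasUnitShift a := by
  refine forall_congr' fun a => exists_congr fun x => ?_
  rw [Set.mem_iInter]
  refine forall_congr' fun i => ⟨?_, ?_⟩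
  · rintro ⟨u, rfl⟩
    simp
  · rintro ⟨u, hu⟩
    exact ⟨u, by rw [hu, add_sub_cancel_right]⟩

theorem hasUnitShift_zero_cons_pair {R : Type*} [Ring R] {a b : R} :
    HasUnitShift ![0, a, b] ↔ ∃ x, IsUnit x ∧ IsUnit (x + a) ∧ IsUnit (x + b) := by
  simp [HasUnitShift, Fin.forall_fin_succ]

theorem satisfiesTranslateCondition_three_iff {R : Type*} [Ring R] :
    SatisfiesTranslateCondition R 3 ↔ ∀ a b : R, HasUnitShift ![0, a, b] := by
  rw [satisfiesTranslateCondition_iff_forall_hasUnitShift]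
  refine ⟨fun h a b => h _, fun h a => .of_add_const (-a 0) ?_⟩
  convert h (a 1 - a 0) (a 2 - a 0) using 1
  ext i
  fin_cases i <;> simp [sub_eq_add_neg]

namespace SatisfiesTranslateCondition

variable {R S : Type*} [Ring R] [Ring S] {n : ℕ}

theorem hasUnitShift (h : SatisfiesTranslateCondition R n) (a : Fin n → R) : HasUnitShift a :=
  satisfiesTranslateCondition_iff_forall_hasUnitShift.1 h a

theorem of_hasHomomorphicImage (h : SatisfiesTranslateCondition R n)
    (hRS : HasHomomorphicImage R S) : SatisfiesTranslateCondition S n := by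
  obtain ⟨f, hf⟩ := hRS
  rw [satisfiesTranslateCondition_iff_forall_hasUnitShift]
  intro a
  obtain ⟨b, rfl⟩ := hf.comp_left a
  exact (h.hasUnitShift b).map f

theorem of_ringEquiv (h : SatisfiesTranslateCondition R n) (e : R ≃+* S) :
    SatisfiesTranslateCondition S n :=
  h.of_hasHomomorphicImage (.of_ringEquiv e)

theorem of_isLocalHom (h : SatisfiesTranslateCondition S n) (f : R →+* S) [IsLocalHom f]
    (hf : Function.Surjective f) : SatisfiesTranslateCondition R n :=
  satisfiesTranslateCondition_iff_forall_hasUnitShift.2 fun _ => .of_map f hf (h.hasUnitShift _)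

theorem of_subsingleton [Subsingleton R] : SatisfiesTranslateCondition R n :=
  satisfiesTranslateCondition_iff_forall_hasUnitShift.2
    fun _ => ⟨0, fun _ => isUnit_of_subsingleton _⟩

theorem pi {ι : Type*} {R : ι → Type*} [∀ i, Ring (R i)]
    (h : ∀ i, SatisfiesTranslateCondition (R i) n) :
    SatisfiesTranslateCondition (∀ i, R i) n := by
  rw [satisfiesTranslateCondition_iff_forall_hasUnitShift]
  intro a
  choose x hx using fun i => (h i).hasUnitShift fun j => a j i
  exact ⟨x, fun j => Pi.isUnit_iff.2 fun i => hx i j⟩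

theorem lt_card [Nontrivial R] (h : SatisfiesTranslateCondition R n) : n < ENat.card R := by
  by_contra! hcard
  have : Finite R := ENat.card_lt_top.1 (hcard.trans_lt (ENat.natCast_lt_top n))
  have := Fintype.ofFinite R
  obtain ⟨e⟩ : Nonempty (R ↪ Fin n) := by
    rw [ENat.card_eq_coe_fintype_card, Nat.cast_le] at hcard
    exact Function.Embedding.nonempty_of_card_le (by simpa using hcard)
  obtain ⟨x, hx⟩ := h.hasUnitShift (Function.invFun e)
  obtain ⟨i, hi⟩ := Function.invFun_surjective e.injective (-x)
  exact not_isUnit_zero (M₀ := R) (by simpa [hi] using hx i)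

end SatisfiesTranslateCondition

theorem satisfiesTranslateCondition_iff_lt_card {D : Type*} [DivisionRing D] {n : ℕ} :
    SatisfiesTranslateCondition D n ↔ n < ENat.card D := by
  refine ⟨fun h => h.lt_card,
    fun hn => satisfiesTranslateCondition_iff_forall_hasUnitShift.2 fun a => ?_⟩
  have hnotsurj : ¬ Function.Surjective fun i => -a i := fun hsurj => hn.not_ge <| by
    simpa using ENat.card_le_card_of_injective (Function.injective_surjInv hsurj)
  obtain ⟨x, hx⟩ := not_forall.1 hnotsurj
  exact ⟨x, fun i => isUnit_iff_ne_zero.2 fun h0 => hx ⟨i, neg_eq_of_add_eq_zero_left h0⟩⟩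

section Blocks

variable {ι l m S : Type*} [Fintype l] [Fintype m] [DecidableEq l] [DecidableEq m] [Ring S]

theorem isUnit_fromBlocks_of_isUnit_schur (A : (Matrix l l S)ˣ) (B : Matrix l m S)
    (C : Matrix m l S) {E : Matrix m m S}
    (h : IsUnit (E - C * (↑A⁻¹ : Matrix l l S) * B)) :
    IsUnit (fromBlocks (A : Matrix l l S) B C E) := by
  obtain ⟨F, hF⟩ := h
  have lower_diagonal_upper : fromBlocks (A : Matrix l l S) B C E =
      fromBlocks 1 0 (C * (↑A⁻¹ : Matrix l l S)) 1 *
        fromBlocks (A : Matrix l l S) 0 0 (F : Matrix m m S) *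
        fromBlocks 1 ((↑A⁻¹ : Matrix l l S) * B) 0 1 := by
    simp [fromBlocks_multiply, hF, Matrix.mul_assoc, ← Matrix.mul_assoc (A : Matrix l l S),
      ← Units.val_mul]
  rw [lower_diagonal_upper]
  refine (IsUnit.mul ?_ ?_).mul ?_
  · exact isUnit_iff_exists.2 ⟨fromBlocks 1 0 (-(C * (↑A⁻¹ : Matrix l l S))) 1, by
      simp [fromBlocks_multiply], by simp [fromBlocks_multiply]⟩
  · exact isUnit_iff_exists.2 ⟨fromBlocks (↑A⁻¹ : Matrix l l S) 0 0 (↑F⁻¹ : Matrix m m S), by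
      simp [fromBlocks_multiply], by simp [fromBlocks_multiply]⟩
  · exact isUnit_iff_exists.2 ⟨fromBlocks 1 (-((↑A⁻¹ : Matrix l l S) * B)) 0 1, by
      simp [fromBlocks_multiply], by simp [fromBlocks_multiply]⟩

theorem HasUnitShift.of_toBlocks₁₁ {a : ι → Matrix (l ⊕ m) (l ⊕ m) S}
    (hl : HasUnitShift fun i => (a i).toBlocks₁₁)
    (hm : ∀ c : ι → Matrix m m S, HasUnitShift c) : HasUnitShift a := by
  obtain ⟨y, hy⟩ := hl
  choose u hu using hy
  obtain ⟨z, hz⟩ := hm fun i =>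
    (a i).toBlocks₂₂ - (a i).toBlocks₂₁ * (↑(u i)⁻¹ : Matrix l l S) * (a i).toBlocks₁₂
  refine ⟨fromBlocks y 0 0 z, fun i => ?_⟩
  rw [← fromBlocks_toBlocks (a i), fromBlocks_add, ← hu]
  apply isUnit_fromBlocks_of_isUnit_schur
  simpa [add_sub_assoc] using hz i

namespace SatisfiesTranslateCondition

variable {n : ℕ}

theorem matrix_of_card_eq (h : SatisfiesTranslateCondition (Matrix l l S) n)
    (hlm : Fintype.card l = Fintype.card m) : SatisfiesTranslateCondition (Matrix m m S) n :=
  h.of_ringEquiv (reindexRingEquiv S (Fintype.equivOfCardEq hlm))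

theorem matrix_sum (hl : SatisfiesTranslateCondition (Matrix l l S) n)
    (hm : SatisfiesTranslateCondition (Matrix m m S) n) :
    SatisfiesTranslateCondition (Matrix (l ⊕ m) (l ⊕ m) S) n :=
  satisfiesTranslateCondition_iff_forall_hasUnitShift.2 fun _ =>
    .of_toBlocks₁₁ (hl.hasUnitShift _) hm.hasUnitShift

theorem matrix_fin (h : SatisfiesTranslateCondition S n) (k : ℕ) :
    SatisfiesTranslateCondition (Matrix (Fin k) (Fin k) S) n := by
  induction k with
  | zero => exact .of_subsingleton
  | succ k ih =>
    have hunit : SatisfiesTranslateCondition (Matrix Unit Unit S) n :=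
      h.of_ringEquiv uniqueRingEquiv.symm
    exact (hunit.matrix_sum ih).matrix_of_card_eq (by simp [add_comm])

end SatisfiesTranslateCondition

end Blocks

section DivisionRing

variable {D m : Type*} [DivisionRing D] [Fintype m]

theorem exists_ne_zero_forall_dotProduct_eq {n : ℕ} (hn : n < Fintype.card m)
    (c : Fin (n + 1) → m → D) : ∃ p : m → D, p ≠ 0 ∧ ∃ t, ∀ i, p ⬝ᵥ c i = t := by
  let f := (of fun k (i : Fin n) => c i.succ k - c 0 k).vecMulLinear
  have hker : f.ker ≠ ⊥ := LinearMap.ker_ne_bot_of_finrank_lt (by simpa)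
  obtain ⟨p, hp, hp0⟩ := Submodule.exists_mem_ne_zero_of_ne_bot hker
  refine ⟨p, hp0, p ⬝ᵥ c 0, Fin.cases rfl fun i => ?_⟩
  rw [← sub_eq_zero, ← dotProduct_sub]
  exact congrFun (LinearMap.mem_ker.1 hp) i

theorem exists_isUnit_row_eq [DecidableEq m] {p : m → D} (hp : p ≠ 0) (i : m) :
    ∃ P : Matrix m m D, IsUnit P ∧ P i = p := by
  have hi : (Pi.single i 1 : m → D) ≠ 0 := by simp
  obtain ⟨g, hg⟩ := Submodule.exists_linearEquiv_restrict_eq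
    ((LinearEquiv.toSpanNonzeroSingleton D _ _ hi).symm ≪≫ₗ
      LinearEquiv.toSpanNonzeroSingleton D _ _ hp)
  have hgi : g (Pi.single i 1) = p := by
    have h := hg ⟨Pi.single i 1, Submodule.mem_span_singleton_self _⟩
    simpa [LinearEquiv.coord_self] using h.symm
  have hinv : LinearMap.toMatrixRight' g.toLinearMap *
      LinearMap.toMatrixRight' g.symm.toLinearMap = 1 := by
    apply toLinearMapRight'.injective
    simp [toLinearMapRight'_mul]
  refine ⟨LinearMap.toMatrixRight' g.toLinearMap,
    isUnit_iff_exists.2 ⟨_, hinv, (mul_eq_one_comm_of_card_eq m m D rfl).1 hinv⟩, ?_⟩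
  rw [← hgi]
  rfl

theorem SatisfiesTranslateCondition.matrix_unit_sum [DecidableEq m] {n : ℕ}
    (hn : n ≤ Fintype.card m) (h : SatisfiesTranslateCondition (Matrix m m D) (n + 1)) :
    SatisfiesTranslateCondition (Matrix (Unit ⊕ m) (Unit ⊕ m) D) (n + 1) := by
  rw [satisfiesTranslateCondition_iff_forall_hasUnitShift]
  intro a
  obtain ⟨p, hp, t, ht⟩ := exists_ne_zero_forall_dotProduct_eq
    (by rw [Fintype.card_sum, Fintype.card_unit]; omega) fun i k => a i k (.inl ())
  obtain ⟨P, hP, rfl⟩ := exists_isUnit_row_eq hp (.inl ())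
  have hpivot (i) : (P * a i * 1).toBlocks₁₁ = of fun _ _ => t := by
    rw [Matrix.mul_one]
    ext
    exact ht i
  refine .of_mul_mul hP isUnit_one (.of_toBlocks₁₁ ⟨1 - of fun _ _ => t, fun i => ?_⟩
    h.hasUnitShift)
  simp only [hpivot, sub_add_cancel, isUnit_one]

theorem SatisfiesTranslateCondition.matrix_fin_of_le {n k l : ℕ} (hnk : n ≤ k) (hkl : k ≤ l)
    (h : SatisfiesTranslateCondition (Matrix (Fin k) (Fin k) D) (n + 1)) :
    SatisfiesTranslateCondition (Matrix (Fin l) (Fin l) D) (n + 1) := by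
  induction l, hkl using Nat.le_induction with
  | base => exact h
  | succ l hkl ih =>
    exact (ih.matrix_unit_sum (by simpa using hnk.trans hkl)).matrix_of_card_eq
      (by simp [add_comm])

end DivisionRing

theorem exists_mul_mul_eq_diagonal_rank {F : Type*} [Field F] {n : ℕ}
    (a : Matrix (Fin n) (Fin n) F) : ∃ P Q : Matrix (Fin n) (Fin n) F, IsUnit P ∧ IsUnit Q ∧
      P * a * Q = diagonal fun i : Fin n => if (i : ℕ) < a.rank then 1 else 0 := by
  obtain ⟨P, Q, e, hP, hQ, hPQ⟩ := a.exists_rank_normal_form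
  let g : Fin a.rank ⊕ Fin (Fintype.card (Fin n) - a.rank) ≃ Fin n :=
    finSumFinEquiv.trans (finCongr (by
      rw [Nat.add_sub_of_le a.rank_le_card_width, Fintype.card_fin]))
  have hg : (fromBlocks 1 0 0 0 : Matrix _ _ F) =
      (diagonal fun i : Fin n => if (i : ℕ) < a.rank then (1 : F) else 0).submatrix g g := by
    rw [submatrix_diagonal_equiv, ← diagonal_one, ← diagonal_zero, fromBlocks_diagonal]
    congr 1
    ext (i | i) <;> simp [g]
  refine ⟨P.submatrix (e.trans g).symm id, Q.submatrix id (e.trans g).symm, ?_, ?_, ?_⟩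
  · exact (isUnit_submatrix_equiv (e.trans g).symm (.refl _)).2 hP
  · exact (isUnit_submatrix_equiv (.refl _) (e.trans g).symm).2 hQ
  · change (P * a * Q).submatrix (e.trans g).symm (e.trans g).symm = _
    rw [hPQ, hg]
    ext i j
    simp [diagonal_apply]

theorem satisfiesTranslateCondition_three_matrix_of_diagonal {F : Type*} [Field F] {n : ℕ}
    (h : ∀ r ≤ n, ∀ b : Matrix (Fin n) (Fin n) F,
      HasUnitShift ![0, diagonal fun i : Fin n => if (i : ℕ) < r then 1 else 0, b]) :
    SatisfiesTranslateCondition (Matrix (Fin n) (Fin n) F) 3 := by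
  rw [satisfiesTranslateCondition_three_iff]
  intro a b
  obtain ⟨P, Q, hP, hQ, hPQ⟩ := exists_mul_mul_eq_diagonal_rank a
  refine .of_mul_mul hP hQ ?_
  convert h a.rank (by simpa using a.rank_le_card_width) (P * b * Q) using 1
  rw [← hPQ]
  ext i : 1
  fin_cases i <;> simp

/-- The determinant of `!![a, b, c; d, e, f; g, h, i]`, written out as a polynomial in the entries
so that `decide` evaluates it directly. -/
def detThree {R : Type*} [CommRing R] (a b c d e f g h i : R) : R :=
  a * (e * i - f * h) - b * (d * i - f * g) + c * (d * h - e * g)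

theorem det_eq_detThree {R : Type*} [CommRing R] (x : Matrix (Fin 3) (Fin 3) R) :
    x.det = detThree (x 0 0) (x 0 1) (x 0 2) (x 1 0) (x 1 1) (x 1 2) (x 2 0) (x 2 1) (x 2 2) := by
  rw [det_fin_three, detThree]
  ring

-- `Bool` replaces `ZMod 2` here because the kernel evaluates its ring operations far faster.
theorem exists_detThree_bool_eq_one : ∀ r < 4, ∀ a b c d e f g h i : Bool,
    ∃ s t u v w x y z k : Bool,
      detThree s t u v w x y z k = 1 ∧
      detThree (s + if 0 < r then 1 else 0) t u v (w + if 1 < r then 1 else 0) x y z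
        (k + if 2 < r then 1 else 0) = 1 ∧
      detThree (s + a) (t + b) (u + c) (v + d) (w + e) (x + f) (y + g) (z + h) (k + i) = 1 := by
  decide +kernel

theorem exists_det_zmod_three_ne_zero : ∀ r < 3, ∀ a b c d : ZMod 3, ∃ x y z w : ZMod 3,
    x * w - y * z ≠ 0 ∧
    (x + if 0 < r then 1 else 0) * (w + if 1 < r then 1 else 0) - y * z ≠ 0 ∧
    (x + a) * (w + d) - (y + b) * (z + c) ≠ 0 := by
  decide +kernel

theorem satisfiesTranslateCondition_matrix_two_zmod_three :
    SatisfiesTranslateCondition (Matrix (Fin 2) (Fin 2) (ZMod 3)) 3 := by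
  refine satisfiesTranslateCondition_three_matrix_of_diagonal fun r hr b => ?_
  obtain ⟨x, y, z, w, h⟩ :=
    exists_det_zmod_three_ne_zero r (by omega) (b 0 0) (b 0 1) (b 1 0) (b 1 1)
  rw [hasUnitShift_zero_cons_pair]
  refine ⟨!![x, y; z, w], ?_⟩
  simpa [isUnit_iff_isUnit_det, det_fin_two] using h

theorem hasUnitShift_zero_cons_diagonal_bool {r : ℕ} (hr : r ≤ 3)
    (b : Matrix (Fin 3) (Fin 3) Bool) :
    HasUnitShift ![0, diagonal fun i : Fin 3 => if (i : ℕ) < r then 1 else 0, b] := by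
  obtain ⟨s, t, u, v, w, x, y, z, k, h⟩ := exists_detThree_bool_eq_one r (by omega)
    (b 0 0) (b 0 1) (b 0 2) (b 1 0) (b 1 1) (b 1 2) (b 2 0) (b 2 1) (b 2 2)
  have isUnit_iff_eq_one : ∀ q : Bool, IsUnit q ↔ q = 1 := by decide
  rw [hasUnitShift_zero_cons_pair]
  refine ⟨!![s, t, u; v, w, x; y, z, k], ?_⟩
  simpa [isUnit_iff_eq_one, isUnit_iff_isUnit_det, det_eq_detThree] using h

theorem satisfiesTranslateCondition_matrix_three_zmod_two :
    SatisfiesTranslateCondition (Matrix (Fin 3) (Fin 3) (ZMod 2)) 3 := by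
  refine satisfiesTranslateCondition_three_matrix_of_diagonal fun r hr b => ?_
  let e : ZMod 2 ≃+* Bool := ZMod.ringEquivOfPrime Bool Nat.prime_two (by simp)
  convert (hasUnitShift_zero_cons_diagonal_bool hr (b.map e)).map e.symm.mapMatrix.toRingHom
  ext i : 1
  fin_cases i <;> simp [Function.comp_def]

theorem not_satisfiesTranslateCondition_zmod_two : ¬ SatisfiesTranslateCondition (ZMod 2) 3 :=
  fun h => absurd h.lt_card (by simp [ENat.card_eq_coe_fintype_card])

theorem not_satisfiesTranslateCondition_zmod_three : ¬ SatisfiesTranslateCondition (ZMod 3) 3 :=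
  fun h => absurd h.lt_card (by simp [ENat.card_eq_coe_fintype_card])

theorem not_satisfiesTranslateCondition_matrix_two_zmod_two :
    ¬ SatisfiesTranslateCondition (Matrix (Fin 2) (Fin 2) (ZMod 2)) 3 := by
  rw [satisfiesTranslateCondition_three_iff]
  intro h
  obtain ⟨x, hx⟩ := hasUnitShift_zero_cons_pair.1 (h 1 !![1, 1; 1, 1])
  have not_all_det_eq_one : ∀ a b c d : ZMod 2,
      ¬ (a * d - b * c = 1 ∧ (a + 1) * (d + 1) - b * c = 1 ∧
        (a + 1) * (d + 1) - (b + 1) * (c + 1) = 1) := by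
    decide
  refine not_all_det_eq_one (x 0 0) (x 0 1) (x 1 0) (x 1 1) ?_
  simpa [isUnit_iff_isUnit_det, det_fin_two] using hx

theorem three_lt_card_or_nonempty_ringEquiv_zmod (R : Type*) [Ring R] [Nontrivial R] :
    3 < ENat.card R ∨ Nonempty (ZMod 2 ≃+* R) ∨ Nonempty (ZMod 3 ≃+* R) := by
  obtain _ | _ := finite_or_infinite R
  · have := Fintype.ofFinite R
    have hone : 1 < Fintype.card R := Fintype.one_lt_card
    obtain hcard | hcard | hcard :
        3 < Fintype.card R ∨ Fintype.card R = 2 ∨ Fintype.card R = 3 := by omega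
    · left
      rw [ENat.card_eq_coe_fintype_card]
      exact_mod_cast hcard
    · exact .inr (.inl ⟨ZMod.ringEquivOfPrime R Nat.prime_two hcard⟩)
    · exact .inr (.inr ⟨ZMod.ringEquivOfPrime R Nat.prime_three hcard⟩)
  · exact .inl (by rw [ENat.card_eq_top_of_infinite]; exact ENat.natCast_lt_top 3)

theorem satisfiesTranslateCondition_three_matrix_of_divisionRing {D : Type*} [DivisionRing D]
    {n : ℕ} [NeZero n]
    (h2 : ¬ HasHomomorphicImage (Matrix (Fin n) (Fin n) D) (ZMod 2))
    (h22 : ¬ HasHomomorphicImage (Matrix (Fin n) (Fin n) D) (Matrix (Fin 2) (Fin 2) (ZMod 2)))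
    (h3 : ¬ HasHomomorphicImage (Matrix (Fin n) (Fin n) D) (ZMod 3)) :
    SatisfiesTranslateCondition (Matrix (Fin n) (Fin n) D) 3 := by
  have hn := NeZero.ne n
  obtain hcard | ⟨⟨e⟩⟩ | ⟨⟨e⟩⟩ := three_lt_card_or_nonempty_ringEquiv_zmod D
  · exact (satisfiesTranslateCondition_iff_lt_card.2 hcard).matrix_fin n
  · have hn1 : n ≠ 1 := by
      rintro rfl
      exact h2 (.of_ringEquiv (uniqueRingEquiv.trans e.symm))
    have hn2 : n ≠ 2 := by
      rintro rfl
      exact h22 (.of_ringEquiv e.symm.mapMatrix)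
    exact (satisfiesTranslateCondition_matrix_three_zmod_two.matrix_fin_of_le (by norm_num)
      (by omega)).of_ringEquiv e.mapMatrix
  · have hn1 : n ≠ 1 := by
      rintro rfl
      exact h3 (.of_ringEquiv (uniqueRingEquiv.trans e.symm))
    exact (satisfiesTranslateCondition_matrix_two_zmod_three.matrix_fin_of_le le_rfl
      (by omega)).of_ringEquiv e.mapMatrix

theorem satisfiesTranslateCondition_three_of_isSemisimpleRing {R : Type*} [Ring R]
    [IsSemisimpleRing R] (h2 : ¬ HasHomomorphicImage R (ZMod 2))
    (h22 : ¬ HasHomomorphicImage R (Matrix (Fin 2) (Fin 2) (ZMod 2)))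
    (h3 : ¬ HasHomomorphicImage R (ZMod 3)) : SatisfiesTranslateCondition R 3 := by
  obtain ⟨k, D, d, _, _, ⟨e⟩⟩ := IsSemisimpleRing.exists_ringEquiv_pi_matrix_divisionRing R
  refine SatisfiesTranslateCondition.of_ringEquiv (.pi fun i => ?_) e.symm
  have hfactor : HasHomomorphicImage R (Matrix (Fin (d i)) (Fin (d i)) (D i)) :=
    .trans (.of_ringEquiv e) ⟨Pi.evalRingHom _ i, Function.surjective_eval i⟩
  exact satisfiesTranslateCondition_three_matrix_of_divisionRing (fun h => h2 (hfactor.trans h))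
    (fun h => h22 (hfactor.trans h)) fun h => h3 (hfactor.trans h)

section Jacobson

variable {R S : Type*} [Ring R] [Ring S]

theorem isUnit_of_sub_one_mem_ringJacobson {x : R} (hx : x - 1 ∈ Ring.jacobson R) : IsUnit x := by
  have exists_mul_eq_one {u : R} (hu : u - 1 ∈ Ring.jacobson R) : ∃ v, v * u = 1 := by
    rw [← Ideal.jacobson_bot] at hu
    simpa [sub_eq_zero] using Ideal.exists_mul_sub_mem_of_sub_one_mem_jacobson u hu
  obtain ⟨y, hyx⟩ := exists_mul_eq_one hx
  have hy : y - 1 ∈ Ring.jacobson R := by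
    have hmul : y - 1 = -y * (x - 1) := by rw [neg_mul, mul_sub, hyx, mul_one, neg_sub]
    exact hmul ▸ Ideal.mul_mem_left _ (-y) hx
  obtain ⟨z, hzy⟩ := exists_mul_eq_one hy
  rw [← left_inv_eq_right_inv hzy hyx]
  exact isUnit_iff_exists.2 ⟨y, hzy, left_inv_eq_right_inv hzy hyx ▸ hyx⟩

instance isLocalHom_mk_ringJacobson : IsLocalHom (Ideal.Quotient.mk (Ring.jacobson R)) where
  map_nonunit u hu := by
    obtain ⟨w, huw, hwu⟩ := isUnit_iff_exists.1 hu
    obtain ⟨v, rfl⟩ := Ideal.Quotient.mk_surjective w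
    rw [← map_mul, ← map_one (Ideal.Quotient.mk _), Ideal.Quotient.eq] at huw hwu
    obtain ⟨a, ha⟩ := (isUnit_of_sub_one_mem_ringJacobson huw).exists_right_inv
    obtain ⟨b, hb⟩ := (isUnit_of_sub_one_mem_ringJacobson hwu).exists_left_inv
    exact isUnit_iff_exists_and_exists.2
      ⟨⟨v * a, by rw [← mul_assoc, ha]⟩, ⟨b * v, by rw [mul_assoc, hb]⟩⟩

theorem ker_le_ringJacobson_of_isLocalHom (f : R →+* S) [IsLocalHom f] :
    RingHom.ker f ≤ Ring.jacobson R := by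
  intro x hx
  rw [← Ideal.jacobson_bot, Ideal.mem_jacobson_iff]
  intro y
  have hunit : IsUnit (y * x + 1) :=
    isUnit_of_map_unit f _ (by simp [RingHom.mem_ker.1 hx])
  obtain ⟨z, hz⟩ := hunit.exists_left_inv
  exact ⟨z, by rw [mul_add, mul_one, ← mul_assoc] at hz; simp [hz]⟩

theorem isSemisimpleRing_quotient_ringJacobson_of_isLocalHom [IsSemisimpleRing S] (f : R →+* S)
    [IsLocalHom f] (hf : Function.Surjective f) : IsSemisimpleRing (R ⧸ Ring.jacobson R) := by
  have : IsSemisimpleRing (R ⧸ RingHom.ker f) :=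
    (RingHom.quotientKerEquivOfSurjective hf).symm.isSemisimpleRing
  exact RingHom.isSemisimpleRing_of_surjective
    (Ideal.Quotient.factor (ker_le_ringJacobson_of_isLocalHom f))
    (Ideal.Quotient.factor_surjective _)

theorem isSemisimpleRing_quotient_ringJacobson_of_mulOpposite
    [IsSemisimpleRing (Rᵐᵒᵖ ⧸ Ring.jacobson Rᵐᵒᵖ)] : IsSemisimpleRing (R ⧸ Ring.jacobson R) := by
  let f : R →+* (Rᵐᵒᵖ ⧸ Ring.jacobson Rᵐᵒᵖ)ᵐᵒᵖ :=
    (RingHom.op (Ideal.Quotient.mk (Ring.jacobson Rᵐᵒᵖ))).comp (RingEquiv.opOp R).toRingHom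
  have hf : Function.Surjective f := MulOpposite.op_surjective.comp
    (Ideal.Quotient.mk_surjective.comp MulOpposite.op_surjective)
  have : IsLocalHom f := ⟨fun x hx => isUnit_op.1 <|
    isUnit_of_map_unit (Ideal.Quotient.mk (Ring.jacobson Rᵐᵒᵖ)) _ (isUnit_unop.2 hx)⟩
  exact isSemisimpleRing_quotient_ringJacobson_of_isLocalHom f hf

theorem isSemisimpleRing_quotient_ringJacobson_of_isArtinian_mulOpposite [IsArtinian Rᵐᵒᵖ R] :
    IsSemisimpleRing (R ⧸ Ring.jacobson R) :=
  have : IsArtinianRing Rᵐᵒᵖ := isArtinian_of_linearEquiv (MulOpposite.opLinearEquiv Rᵐᵒᵖ)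
  isSemisimpleRing_quotient_ringJacobson_of_mulOpposite

end Jacobson

theorem mainTheorem11_general {R : Type*} [Ring R] [IsSemisimpleRing (R ⧸ Ring.jacobson R)] :
    SatisfiesTranslateCondition R 3 ↔
      ¬ HasHomomorphicImage R (ZMod 2) ∧
      ¬ HasHomomorphicImage R (Matrix (Fin 2) (Fin 2) (ZMod 2)) ∧
      ¬ HasHomomorphicImage R (ZMod 3) := by
  constructor
  · intro h
    exact ⟨fun h2 => not_satisfiesTranslateCondition_zmod_two (h.of_hasHomomorphicImage h2),
      fun h22 => not_satisfiesTranslateCondition_matrix_two_zmod_two (h.of_hasHomomorphicImage h22),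
      fun h3 => not_satisfiesTranslateCondition_zmod_three (h.of_hasHomomorphicImage h3)⟩
  · rintro ⟨h2, h22, h3⟩
    have hquot : HasHomomorphicImage R (R ⧸ Ring.jacobson R) := ⟨_, Ideal.Quotient.mk_surjective⟩
    refine .of_isLocalHom ?_ (Ideal.Quotient.mk (Ring.jacobson R)) Ideal.Quotient.mk_surjective
    exact satisfiesTranslateCondition_three_of_isSemisimpleRing (fun h => h2 (hquot.trans h))
      (fun h => h22 (hquot.trans h)) fun h => h3 (hquot.trans h)

theorem mainTheorem11 {R : Type*} [Ring R]
    (hR : IsArtinian R R ∨ IsArtinian Rᵐᵒᵖ R) :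
    SatisfiesTranslateCondition R 3 ↔
      ¬ HasHomomorphicImage R (ZMod 2) ∧
      ¬ HasHomomorphicImage R (Matrix (Fin 2) (Fin 2) (ZMod 2)) ∧
      ¬ HasHomomorphicImage R (ZMod 3) := by
  have : IsSemisimpleRing (R ⧸ Ring.jacobson R) := hR.elim (fun _ => inferInstance)
    fun _ => isSemisimpleRing_quotient_ringJacobson_of_isArtinian_mulOpposite
  exact mainTheorem11_general
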